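/- Let $n\ge 2$ and let $a_1,\dots,a_n$ be the annihilation operators of $n$ fermionic sites, acting on the $2^n$-dimensional Fock space with vacuum $|0\rangle$. Let $\gamma\in\mathbb C$ with $\operatorname{Im}\gamma\neq 0$ and $|\gamma|\neq 1$, and let $M$ be the Hermitian $n\times n$ matrix with $M_{ii}=1$, $M_{ij}=-i\,\operatorname{Im}\gamma\,(\gamma^*)^{j-i-1}$ for $i<j$, and $M_{ij}=i\,\operatorname{Im}\gamma\,\gamma^{\,i-j-1}$ for $i>j$. Assume that $M$ is positive definite, and let $\eta$ be the unique operator on Fock space with $\eta a_i^\dagger=\sum_j M_{ji}a_j^\dagger\eta$ for all $i$ and $\eta|0\rangle=|0\rangle$. An operator $O$ is an observable if $\eta O=O^\dagger\eta$. It is (Bravyi–Kitaev) local to $S\subseteq[n]=\{1,\dots,n\}$ if it lies in the linear span of the products $\left(\prod_{i\in A}a_i^\dagger\right)\left(\prod_{j\in B}a_j\right)$ with $A,B\subseteq S$ and $|A|+|B|$ even, and it is extensively local over $S$ if in addition it is not local to any proper subset of $S$. A set $C\subseteq[n]$ is connected if it is a nonempty set of consecutive sites. For $S\subseteq[n]$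 put $K(S)=\dim\ker\left(M_{ij}\right)_{i\notin S,\,j\in S}$, the kernel being taken in $\mathbb C^S$. Then: 1. for every connected $C\subseteq[n]$ with $|C|\ge 3$ there is an observable that is extensively local over $C$; 2. there are observables that are extensively local over $\{1,2\}$ and over $\{n-1,n\}$, respectively; 3. if $C\subseteq[n]$ is any other connected set, then every observable that is local to $C$ is a multiple of the identity; 4. for every connected $C$ with $|C|\ge 2$, $K(C)=|C|-2+[1\in C]+[n\in C]$, where $[\cdot]$ is $1$ if the condition holds and $0$ otherwise, and $K(C)=0$ for every connected $C$ with $|C|=1$. -/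

import Mathlib

open scoped Matrix ComplexOrder

noncomputable section

namespace FreeFermion

/-- Operators on the fermionic Fock space over the sites `Fin n` (dimension `2 ^ n`), written in
the orthonormal occupation basis, which is labelled by the sets of occupied sites. The adjoint is
the conjugate transpose. -/
abbrev Op (n : ℕ) : Type := Matrix (Finset (Fin n)) (Finset (Fin n)) ℂ

/-- The vacuum vector: the basis vector of the empty set. -/
def vacuum (n : ℕ) : Finset (Fin n) → ℂ := Pi.single ∅ 1

/-- The sign picked up when moving a creation operator past the occupied sites to its left. -/
def sgn {n : ℕ} (i : Fin n) (S : Finset (Fin n)) : ℂ := (-1) ^ (S.filter (fun j => j < i)).card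

/-- The creation operator of site `i`: it sends the basis vector of `S` to `0` if `i ∈ S`, and to
`± ` the basis vector of `insert i S` otherwise. -/
def creation {n : ℕ} (i : Fin n) : Op n :=
  Matrix.of fun T S => if i ∉ S ∧ T = insert i S then sgn i S else 0

/-- The annihilation operator of site `i`: the adjoint of the creation operator. -/
def annihilation {n : ℕ} (i : Fin n) : Op n := (creation i)ᴴ

/-- The product of the operators `c i`, `i ∈ A`, in increasing order of `i`. -/
def orderedProd {n : ℕ} (c : Fin n → Op n) (A : Finset (Fin n)) : Op n :=
  ((A.sort (· ≤ ·)).map c).prod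

/-- The span of the even products of creation and annihilation operators with indices in `S`. -/
def evenSpan {n : ℕ} (S : Finset (Fin n)) : Submodule ℂ (Op n) :=
  Submodule.span ℂ
    {X | ∃ A B : Finset (Fin n), A ⊆ S ∧ B ⊆ S ∧ Even (A.card + B.card) ∧
      X = orderedProd creation A * orderedProd annihilation B}

/-- Bravyi–Kitaev locality of an operator to the set of sites `S`. -/
def IsLocal {n : ℕ} (S : Finset (Fin n)) (O : Op n) : Prop := O ∈ evenSpan S

/-- Bravyi–Kitaev extensive locality: local to `S`, but to no proper subset of `S`. -/
def IsExtensivelyLocal {n : ℕ} (S : Finset (Fin n)) (O : Op n) : Prop :=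
  IsLocal S O ∧ ∀ S₁ : Finset (Fin n), S₁ ⊂ S → ¬ IsLocal S₁ O

/-- `η` is the total metric of the reduced metric `M`: it satisfies
`η a†_i = ∑_j M_{ji} a†_j η` for all `i`, and it fixes the vacuum. -/
def IsTotalMetric {n : ℕ} (M : Matrix (Fin n) (Fin n) ℂ) (η : Op n) : Prop :=
  (∀ i, η * creation i = (∑ j, M j i • creation j) * η) ∧ η *ᵥ vacuum n = vacuum n

/-- Observables of the theory with metric `η`: the quasi-Hermitian operators. -/
def IsObservable {n : ℕ} (η O : Op n) : Prop := η * O = Oᴴ * η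

/-- The set of sites `S` contains extensively local observables. -/
def HasExtensivelyLocalObservable {n : ℕ} (η : Op n) (S : Finset (Fin n)) : Prop :=
  ∃ O : Op n, IsObservable η O ∧ IsExtensivelyLocal S O

/-- The set of sites `S` contains nontrivial local observables. Multiples of the identity, which
are local to every set of sites, are the trivial ones. -/
def HasLocalObservable {n : ℕ} (η : Op n) (S : Finset (Fin n)) : Prop :=
  ∃ O : Op n, IsObservable η O ∧ IsLocal S O ∧ ∀ c : ℂ, O ≠ c • (1 : Op n)

/-- The reduced metric of the chain with farthest impurities `γ`, `γ*` at its two ends. -/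
def farMetric (n : ℕ) (γ : ℂ) : Matrix (Fin n) (Fin n) ℂ :=
  Matrix.of fun i j =>
    if i = j then 1
    else if i < j then -(Complex.I * (γ.im : ℂ)) * (starRingEnd ℂ γ) ^ (j.val - i.val - 1)
    else Complex.I * (γ.im : ℂ) * γ ^ (i.val - j.val - 1)

/-- `K(S) = dim ker M^{S' S}`, where `M^{S' S}` is the block of `M` with rows outside `S` and
columns in `S`. -/
def kerDim {n : ℕ} (M : Matrix (Fin n) (Fin n) ℂ) (S : Finset (Fin n)) : ℕ :=
  Module.finrank ℂ (LinearMap.ker (M.toBlock (fun i => i ∉ S) (fun j => j ∈ S)).mulVecLin)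

/-- The graph with vertex set `C` and an edge between any two consecutive sites of `C` is
connected (in particular, `C` is not empty). -/
def IsConnectedSubsystem {n : ℕ} (C : Finset (Fin n)) : Prop :=
  ((SimpleGraph.pathGraph n).induce {i | i ∈ C}).Connected

/-! The operators above satisfy the canonical anticommutation relations, and the total metric of
a reduced metric exists and is unique. -/

theorem creation_mulVec_single {n : ℕ} (i : Fin n) (S : Finset (Fin n)) :
    creation i *ᵥ (Pi.single S 1 : Finset (Fin n) → ℂ)
      = if i ∈ S then 0 else sgn i S • (Pi.single (insert i S) 1 : Finset (Fin n) → ℂ) := by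
  ext T
  rw [Matrix.mulVec_single_one]
  by_cases h : i ∈ S
  · simp [creation, h]
  · simp [creation, h, Pi.single_apply]

theorem annihilation_mulVec_single {n : ℕ} (i : Fin n) (S : Finset (Fin n)) :
    annihilation i *ᵥ (Pi.single S 1 : Finset (Fin n) → ℂ)
      = if i ∈ S then sgn i S • (Pi.single (S.erase i) 1 : Finset (Fin n) → ℂ) else 0 := by
  ext T
  rw [Matrix.mulVec_single_one]
  have hs : ∀ U : Finset (Fin n), star (sgn i U) = sgn i U := by
    intro U; simp [sgn]
  have he : sgn i (S.erase i) = sgn i S := by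
    unfold sgn; congr 2; ext j; simp only [Finset.mem_filter, Finset.mem_erase]
    constructor
    · rintro ⟨⟨-, h1⟩, h2⟩; exact ⟨h1, h2⟩
    · rintro ⟨h1, h2⟩; exact ⟨⟨h2.ne, h1⟩, h2⟩
  by_cases h : i ∈ S
  · by_cases hT : T = S.erase i
    · subst hT
      simp [annihilation, creation, h, he]
      simp [sgn]
    · have : ¬ (i ∉ T ∧ S = insert i T) := by
        rintro ⟨h1, h2⟩
        exact hT (by rw [h2, Finset.erase_insert h1])
      simp [annihilation, creation, h, this, hT]
  · have : ¬ (i ∉ T ∧ S = insert i T) := by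
      rintro ⟨-, h2⟩
      exact h (h2 ▸ Finset.mem_insert_self i T)
    simp [annihilation, creation, h, this]

theorem op_ext {n : ℕ} {X Y : Op n}
    (h : ∀ S, X *ᵥ (Pi.single S 1 : Finset (Fin n) → ℂ) = Y *ᵥ Pi.single S 1) : X = Y := by
  ext T S
  have := congrFun (h S) T
  simpa [Matrix.mulVec_single_one] using this

theorem sgn_insert {n : ℕ} {i j : Fin n} {S : Finset (Fin n)} (hj : j ∉ S) :
    sgn i (insert j S) = if j < i then - sgn i S else sgn i S := by
  unfold sgn
  rw [Finset.filter_insert]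
  split_ifs with h
  · rw [Finset.card_insert_of_notMem (by simp [hj]), pow_succ]; ring
  · rfl

theorem sgn_erase {n : ℕ} {i j : Fin n} {S : Finset (Fin n)} (hj : j ∈ S) :
    sgn i (S.erase j) = if j < i then - sgn i S else sgn i S := by
  have := sgn_insert (i := i) (Finset.notMem_erase j S)
  rw [Finset.insert_erase hj] at this
  rw [this]; split_ifs <;> simp

theorem creation_anticomm {n : ℕ} (i j : Fin n) :
    creation i * creation j + creation j * creation i = (0 : Op n) := by
  apply op_ext
  intro S
  rw [Matrix.add_mulVec, ← Matrix.mulVec_mulVec, ← Matrix.mulVec_mulVec, Matrix.zero_mulVec,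
    creation_mulVec_single, creation_mulVec_single]
  by_cases hi : i ∈ S <;> by_cases hj : j ∈ S <;>
    simp only [hi, hj, if_true, if_false, Matrix.mulVec_zero, Matrix.mulVec_smul,
      creation_mulVec_single, Finset.mem_insert, or_true, smul_zero, add_zero, or_false]
  by_cases hij : i = j
  · simp [hij]
  · rw [if_neg hij, if_neg (Ne.symm hij), sgn_insert hj, sgn_insert hi, Finset.insert_comm i j,
      smul_smul, smul_smul, ← add_smul]
    rcases lt_or_gt_of_ne hij with h | h
    · rw [if_neg h.not_gt, if_pos h]; ring_nf; simp
    · rw [if_pos h, if_neg h.not_gt]; ring_nf; simp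

theorem annihilation_creation {n : ℕ} (i j : Fin n) :
    annihilation i * creation j + creation j * annihilation i
      = if i = j then (1 : Op n) else 0 := by
  apply op_ext
  intro S
  have hsq : ∀ (k : Fin n) (U : Finset (Fin n)), sgn k U * sgn k U = 1 := by
    intro k U; unfold sgn; rw [← mul_pow]; simp
  rw [Matrix.add_mulVec, ← Matrix.mulVec_mulVec, ← Matrix.mulVec_mulVec,
    creation_mulVec_single, annihilation_mulVec_single]
  by_cases hij : i = j
  · subst hij
    by_cases hi : i ∈ S
    · rw [if_pos hi, if_pos hi, if_pos rfl, Matrix.mulVec_zero, zero_add, Matrix.mulVec_smul,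
        creation_mulVec_single, if_neg (Finset.notMem_erase i S), sgn_erase hi,
        if_neg (lt_irrefl i), smul_smul, hsq, one_smul, Finset.insert_erase hi, Matrix.one_mulVec]
    · rw [if_neg hi, if_neg hi, if_pos rfl, Matrix.mulVec_zero, add_zero, Matrix.mulVec_smul,
        annihilation_mulVec_single, if_pos (Finset.mem_insert_self i S), sgn_insert hi,
        if_neg (lt_irrefl i), smul_smul, hsq, one_smul, Finset.erase_insert hi, Matrix.one_mulVec]
  · rw [if_neg hij, Matrix.zero_mulVec]
    by_cases hi : i ∈ S <;> by_cases hj : j ∈ S <;>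
      simp only [hi, hj, if_true, if_false, Matrix.mulVec_zero, Matrix.mulVec_smul,
        creation_mulVec_single, annihilation_mulVec_single, Finset.mem_insert, Finset.mem_erase,
        or_true, smul_zero, add_zero, or_false, and_true, ne_eq, Ne.symm hij,
        hij, not_false_eq_true]
    rw [if_neg (by simp), sgn_insert hj, sgn_erase hi,
      Finset.erase_insert_of_ne (Ne.symm hij), smul_smul, smul_smul, ← add_smul]
    rcases lt_or_gt_of_ne hij with h | h
    · rw [if_neg h.not_gt, if_pos h]; ring_nf; simp
    · rw [if_pos h, if_neg h.not_gt]; ring_nf; simp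

theorem mul_prod_map {n : ℕ} (d : Fin n → Op n) (hd : ∀ i j, d i * d j + d j * d i = 0)
    (i : Fin n) (l : List (Fin n)) (hl : l.Pairwise (· < ·)) :
    d i * (l.map d).prod = if i ∈ l then 0 else
      ((-1 : ℂ) ^ (l.countP (fun j => j < i))) • ((l.orderedInsert (· ≤ ·) i).map d).prod := by
  have hsq : ∀ k, d k * d k = 0 := by
    intro k
    have h := hd k k
    rw [← two_smul ℂ] at h
    exact (smul_eq_zero.mp h).resolve_left two_ne_zero
  induction l with
  | nil => simp
  | cons b l ih =>
    rw [List.pairwise_cons] at hl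
    rcases lt_trichotomy i b with h | h | h
    · have h1 : i ∉ b :: l := by
        intro hm
        rcases List.mem_cons.mp hm with h2 | h2
        · exact h.ne h2
        · exact (h.trans (hl.1 i h2)).false
      have h2 : (b :: l).countP (fun j => j < i) = 0 := by
        rw [List.countP_eq_zero]
        intro j hj
        rcases List.mem_cons.mp hj with h3 | h3
        · subst h3; simpa using h.le
        · simpa using (h.trans (hl.1 j h3)).le
      rw [if_neg h1, h2, List.orderedInsert_cons_of_le _ _ h.le]
      simp
    · subst h
      simp [← mul_assoc, hsq]
    · have h3 : d i * d b = - (d b * d i) := eq_neg_of_add_eq_zero_left (hd i b)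
      rw [List.map_cons, List.prod_cons, ← mul_assoc, h3, neg_mul, mul_assoc, ih hl.2]
      by_cases hm : i ∈ l
      · simp [hm]
      · have h4 : i ∉ b :: l := by
          simp [hm, h.ne']
        rw [if_neg hm, if_neg h4, List.orderedInsert_of_not_le (· ≤ ·) _ h.not_ge, List.map_cons,
          List.prod_cons, List.countP_cons_of_pos (by simpa using h), pow_succ]
        simp

theorem mul_orderedProd {n : ℕ} (d : Fin n → Op n) (hd : ∀ i j, d i * d j + d j * d i = 0)
    (i : Fin n) (S : Finset (Fin n)) :
    d i * orderedProd d S = if i ∈ S then 0 else sgn i S • orderedProd d (insert i S) := by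
  unfold orderedProd
  have hlt : (S.sort (· ≤ ·)).Pairwise (· < ·) := S.sortedLT_sort.pairwise
  rw [mul_prod_map d hd i _ hlt]
  by_cases h : i ∈ S
  · simp [h]
  · rw [if_neg (by simpa using h), if_neg h]
    have h1 : (S.sort (· ≤ ·)).countP (fun j => j < i) = (S.filter (fun j => j < i)).card := by
      rw [← Multiset.coe_countP, Finset.sort_eq, Multiset.countP_eq_card_filter]
      rfl
    have h2 : (S.sort (· ≤ ·)).orderedInsert (· ≤ ·) i = (insert i S).sort (· ≤ ·) := by
      refine List.Perm.eq_of_pairwise (le := (· ≤ ·)) (fun a b _ _ => le_antisymm)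
        ((Finset.pairwise_sort S (· ≤ ·)).orderedInsert i _)
        (Finset.pairwise_sort (insert i S) (· ≤ ·)) ?_
      refine (List.perm_orderedInsert _ i _).trans ?_
      rw [← Multiset.coe_eq_coe, Finset.sort_eq, Finset.insert_val_of_notMem h,
        ← Multiset.cons_coe, Finset.sort_eq]
    rw [h1, h2]
    rfl

theorem existsUnique_isTotalMetric {n : ℕ} (M : Matrix (Fin n) (Fin n) ℂ) :
    ∃! η : Op n, IsTotalMetric M η := by
  set d : Fin n → Op n := fun i => ∑ j, M j i • creation j with hdd
  have hd : ∀ i j, d i * d j + d j * d i = 0 := by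
    intro i j
    have h1 : d i * d j = ∑ k, ∑ l, (M k i * M l j) • (creation k * creation l) := by
      rw [hdd, Finset.sum_mul_sum]
      simp only [smul_mul_smul_comm]
    have h2 : d j * d i = ∑ k, ∑ l, (M k i * M l j) • (creation l * creation k) := by
      rw [Finset.sum_comm, hdd, Finset.sum_mul_sum]
      simp only [smul_mul_smul_comm]
      refine Finset.sum_congr rfl fun l _ => Finset.sum_congr rfl fun k _ => ?_
      rw [mul_comm]
    rw [h1, h2, ← Finset.sum_add_distrib]
    refine Finset.sum_eq_zero fun k _ => ?_
    rw [← Finset.sum_add_distrib]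
    refine Finset.sum_eq_zero fun l _ => ?_
    rw [← smul_add, creation_anticomm, smul_zero]
  let η : Op n := Matrix.of fun T S => (orderedProd d S *ᵥ vacuum n) T
  have hη : ∀ S, η *ᵥ (Pi.single S 1 : Finset (Fin n) → ℂ) = orderedProd d S *ᵥ vacuum n := by
    intro S; ext T; rw [Matrix.mulVec_single_one]; rfl
  refine ⟨η, ⟨fun i => op_ext fun S => ?_, ?_⟩, ?_⟩
  · change _ = (d i * η) *ᵥ _
    rw [← Matrix.mulVec_mulVec, ← Matrix.mulVec_mulVec, creation_mulVec_single, hη,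
      Matrix.mulVec_mulVec, mul_orderedProd d hd]
    split_ifs
    · simp
    · rw [Matrix.mulVec_smul, hη, Matrix.smul_mulVec]
  · have := hη ∅
    change η *ᵥ vacuum n = _ at this
    rw [this]; simp [orderedProd]
  · rintro η' ⟨h1, h2⟩
    refine op_ext fun S => ?_
    induction S using Finset.induction_on with
    | empty =>
      have h3 := hη ∅
      change η' *ᵥ vacuum n = _
      rw [h2, h3]; simp [orderedProd]
    | insert i S hi ih =>
      have hsq : sgn i S * sgn i S = 1 := by
        unfold sgn; rw [← mul_pow]; simp
      have h3 : (Pi.single (insert i S) 1 : Finset (Fin n) → ℂ)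
          = sgn i S • creation i *ᵥ Pi.single S 1 := by
        rw [creation_mulVec_single, if_neg hi, smul_smul, hsq, one_smul]
      rw [hη, h3, Matrix.mulVec_smul, Matrix.mulVec_mulVec, h1, ← Matrix.mulVec_mulVec, ih, hη,
        Matrix.mulVec_mulVec]
      change sgn i S • (d i * orderedProd d S) *ᵥ _ = _
      rw [mul_orderedProd d hd, if_neg hi, Matrix.smul_mulVec, smul_smul, hsq, one_smul]

end FreeFermion

end

open scoped Matrix ComplexOrder

noncomputable section

namespace FreeFermion

variable {n : ℕ}

/-! Everything reduces to one-particle states `v` such that both `v` and `M v` are supported in `S`;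
the space of these is the kernel counted by `kerDim`.

Such a `v` yields an observable: `η` carries `a†(v)` to `a†(M v)` and `a(M v)` to `a(v)`, so `a†(v)
a(M v)` is quasi-Hermitian. It is local to `S`, and extensively so if `v` vanishes nowhere on `S`
(`hasExtensivelyLocalObservable_of_vector`). Conversely, if `O` is a local observable, `Oᴴ = η O
η⁻¹` commutes with `a†(e_k)` and `a†(M e_k)` for `k ∉ S`. The orthogonal complement of these vectors
`e_k`, `M e_k` is the same space of states. If it is zero, `Oᴴ` commutes with every creation
operator and is scalar (`not_hasLocalObservable`).

For a segment, the rows of `farMetric` on either side of it are multiples of a single geometric row.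
Each side that has sites thus imposes one linear condition, and the two conditions are independent
when the segment has at least two sites and `|γ| ≠ 1`. Rank-nullity gives the kernel dimensions, and
explicit vectors on two or three adjacent sites give the observables. -/

theorem conjTranspose_creation (i : Fin n) : (creation i : Op n)ᴴ = annihilation i := rfl

theorem conjTranspose_annihilation (i : Fin n) : (annihilation i : Op n)ᴴ = creation i :=
  Matrix.conjTranspose_conjTranspose _

theorem annihilation_anticomm (i j : Fin n) :
    annihilation i * annihilation j + annihilation j * annihilation i = (0 : Op n) := by
  have h := congrArg Matrix.conjTranspose (creation_anticomm j i)
  simpa [Matrix.conjTranspose_mul, conjTranspose_creation] using h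

theorem creation_mulVec_vacuum (i : Fin n) :
    creation i *ᵥ vacuum n = Pi.single {i} 1 := by
  rw [vacuum, creation_mulVec_single]
  simp [sgn]

theorem annihilation_mulVec_vacuum (i : Fin n) : annihilation i *ᵥ vacuum n = 0 := by
  rw [vacuum, annihilation_mulVec_single]
  simp

theorem annihilation_mulVec_single_self (i : Fin n) :
    annihilation i *ᵥ (Pi.single {i} 1 : Finset (Fin n) → ℂ) = vacuum n := by
  rw [annihilation_mulVec_single]
  simp [sgn, vacuum, Finset.filter_singleton]

/-- The vacuum is cyclic for the creation operators. -/
theorem op_eq_zero {X : Op n} (h0 : X *ᵥ vacuum n = 0)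
    (h : ∀ i, ∃ L : Op n, X * creation i = L * X) : X = 0 := by
  refine op_ext fun S => ?_
  induction S using Finset.induction_on with
  | empty => rw [Matrix.zero_mulVec]; exact h0
  | insert i S hi ih =>
    have hsq : sgn i S * sgn i S = 1 := by
      unfold sgn; rw [← mul_pow]; simp
    have h3 : (Pi.single (insert i S) 1 : Finset (Fin n) → ℂ)
        = sgn i S • creation i *ᵥ Pi.single S 1 := by
      rw [creation_mulVec_single, if_neg hi, smul_smul, hsq, one_smul]
    obtain ⟨L, hL⟩ := h i
    rw [h3, Matrix.mulVec_smul, Matrix.mulVec_mulVec, hL, ← Matrix.mulVec_mulVec, ih]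
    simp only [Matrix.zero_mulVec, Matrix.mulVec_zero, smul_zero]

/-- A vector annihilated by all annihilation operators is a multiple of the vacuum. -/
theorem eq_smul_vacuum {x : Finset (Fin n) → ℂ} (h : ∀ i, annihilation i *ᵥ x = 0) :
    x = x ∅ • vacuum n := by
  ext T
  rcases T.eq_empty_or_nonempty with rfl | ⟨i, hi⟩
  · simp [vacuum]
  · have hT : T ≠ ∅ := by rintro rfl; simp at hi
    -- Removing `i` is injective on sets containing `i`, so one coordinate of `a_i x` recovers `x T`
    -- up to sign.
    have h1 : (annihilation i *ᵥ x) (T.erase i) = sgn i (T.erase i) * x T := by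
      rw [Matrix.mulVec, dotProduct, Finset.sum_eq_single T]
      · have : (annihilation i : Op n) (T.erase i) T = sgn i (T.erase i) := by
          simp [annihilation, creation, Finset.insert_erase hi, sgn]
        rw [this]
      · intro S _ hS
        have : (annihilation i : Op n) (T.erase i) S = 0 := by
          simp [annihilation, creation, Finset.insert_erase hi, hS]
        rw [this, zero_mul]
      · simp
    have h2 : sgn i (T.erase i) ≠ 0 := by simp [sgn]
    rw [h i] at h1
    have h3 : x T = 0 := by simpa [h2] using h1.symm
    simp [vacuum, hT, h3]

/-- An operator that commutes with all creation operators and has the vacuum as an eigenvector is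
a multiple of the identity. -/
theorem eq_smul_one_of_commute {X : Op n} (h : ∀ i, Commute X (creation i)) {c : ℂ}
    (hc : X *ᵥ vacuum n = c • vacuum n) : X = c • 1 := by
  rw [← sub_eq_zero]
  refine op_eq_zero ?_ fun i => ⟨creation i, ?_⟩
  · rw [Matrix.sub_mulVec, hc, Matrix.smul_mulVec, Matrix.one_mulVec, sub_self]
  · rw [sub_mul, mul_sub, (h i).eq]; simp

/-- The creation operator `∑ i, v i a†_i` of the one-particle state `v`. -/
def create : (Fin n → ℂ) →ₗ[ℂ] Op n := Fintype.linearCombination ℂ creation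

theorem create_apply (v : Fin n → ℂ) : create v = ∑ i, v i • creation i := rfl

theorem create_single (i : Fin n) : create (Pi.single i 1) = creation i := by
  simp [create_apply, Pi.single_apply]

theorem conjTranspose_create (v : Fin n → ℂ) :
    (create v)ᴴ = ∑ i, star (v i) • annihilation i := by
  simp [create_apply, Matrix.conjTranspose_sum, conjTranspose_creation]

theorem create_mulVec_vacuum (v : Fin n → ℂ) (i : Fin n) :
    (create v *ᵥ vacuum n) {i} = v i := by
  simp [create_apply, Matrix.sum_mulVec, Matrix.smul_mulVec, creation_mulVec_vacuum,
    Pi.single_apply]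

/-! ### The total metric and one-particle operators -/

namespace IsTotalMetric

variable {M : Matrix (Fin n) (Fin n) ℂ} {η : Op n}

theorem mul_create (hη : IsTotalMetric M η) (v : Fin n → ℂ) :
    η * create v = create (M *ᵥ v) * η := by
  simp only [create_apply, Finset.mul_sum, mul_smul_comm, hη.1, Finset.sum_mul, smul_mul_assoc,
    Finset.smul_sum, smul_smul, Matrix.mulVec, dotProduct, Finset.sum_smul]
  rw [Finset.sum_comm]
  simp only [mul_comm]

/-- Taking adjoints of the defining relation would give a statement about `ηᴴ`; cyclicity of the
vacuum gives one about `η` itself, for any `M`. -/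
theorem mul_annihilation (hη : IsTotalMetric M η) (i : Fin n) :
    η * ∑ j, M i j • annihilation j = annihilation i * η := by
  rw [eq_comm, ← sub_eq_zero]
  -- Moving `creation k` through either term produces the same scalar `M i k` times `η`; it cancels
  -- in the difference.
  refine op_eq_zero ?_ fun k => ⟨-∑ j, M j k • creation j, ?_⟩
  · rw [Matrix.sub_mulVec, ← Matrix.mulVec_mulVec, hη.2, annihilation_mulVec_vacuum,
      ← Matrix.mulVec_mulVec]
    simp [Matrix.sum_mulVec, Matrix.smul_mulVec, annihilation_mulVec_vacuum]
  · have h1 : annihilation i * ∑ j, M j k • creation j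
        = M i k • (1 : Op n) - (∑ j, M j k • creation j) * annihilation i := by
      rw [eq_sub_iff_add_eq, Finset.mul_sum, Finset.sum_mul, ← Finset.sum_add_distrib]
      simp only [mul_smul_comm, smul_mul_assoc, ← smul_add, annihilation_creation]
      simp
    have h2 : (∑ j, M i j • annihilation j) * creation k
        = M i k • (1 : Op n) - creation k * ∑ j, M i j • annihilation j := by
      rw [eq_sub_iff_add_eq, Finset.mul_sum, Finset.sum_mul, ← Finset.sum_add_distrib]
      simp only [mul_smul_comm, smul_mul_assoc, ← smul_add, annihilation_creation]
      simp
    rw [sub_mul, mul_assoc, mul_assoc, hη.1, h2, ← mul_assoc, h1, mul_sub, ← mul_assoc η (creation k),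
      hη.1, neg_mul, mul_sub, sub_mul]
    simp only [smul_mul_assoc, one_mul, mul_smul_comm, mul_one, mul_assoc]
    abel

theorem mul_conjTranspose_create (hη : IsTotalMetric M η) (hM : M.IsHermitian) (v : Fin n → ℂ) :
    η * (create (M *ᵥ v))ᴴ = (create v)ᴴ * η := by
  have h : (create (M *ᵥ v))ᴴ = ∑ i, star (v i) • ∑ j, M i j • annihilation j := by
    simp only [conjTranspose_create, Matrix.mulVec, dotProduct, star_sum, star_mul, Finset.sum_smul,
      Finset.smul_sum, smul_smul, hM.apply]
    rw [Finset.sum_comm]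
  rw [h, conjTranspose_create, Finset.mul_sum, Finset.sum_mul]
  simp only [mul_smul_comm, hη.mul_annihilation, smul_mul_assoc]

/-- The total metric of `M⁻¹` is a left inverse: the product commutes with all creation operators
and fixes the vacuum. -/
theorem isUnit (hη : IsTotalMetric M η) (hM : IsUnit M) : IsUnit η := by
  obtain ⟨η', hη', -⟩ := existsUnique_isTotalMetric M⁻¹
  have hM' : M⁻¹ * M = 1 := Matrix.nonsing_inv_mul M ((Matrix.isUnit_iff_isUnit_det M).1 hM)
  have h : η' * η = (1 : ℂ) • 1 := by
    refine eq_smul_one_of_commute (fun i => ?_) ?_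
    · rw [Commute, SemiconjBy, ← create_single, mul_assoc, hη.mul_create, ← mul_assoc,
        hη'.mul_create, Matrix.mulVec_mulVec, hM', Matrix.one_mulVec, mul_assoc]
    · rw [← Matrix.mulVec_mulVec, hη.2, hη'.2, one_smul]
  rw [one_smul] at h
  exact IsUnit.of_mul_eq_one_right η' h

/-- The one-particle operator `a†(v) a(M v)` is quasi-Hermitian. -/
theorem isObservable_create_mul (hη : IsTotalMetric M η) (hM : M.IsHermitian) (v : Fin n → ℂ) :
    IsObservable η (create v * (create (M *ᵥ v))ᴴ) := by
  rw [IsObservable, ← mul_assoc, hη.mul_create, mul_assoc, hη.mul_conjTranspose_create hM,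
    Matrix.conjTranspose_mul, Matrix.conjTranspose_conjTranspose, mul_assoc]

end IsTotalMetric

/-! ### Locality and the two criteria for observables -/

theorem mul_prod_of_anticomm {d : Op n} (l : List (Op n)) (h : ∀ x ∈ l, d * x + x * d = 0) :
    d * l.prod = (-1 : ℂ) ^ l.length • (l.prod * d) := by
  induction l with
  | nil => simp
  | cons x l ih =>
    have hx : d * x = -(x * d) := eq_neg_of_add_eq_zero_left (h x (by simp))
    rw [List.prod_cons, ← mul_assoc, hx, neg_mul, mul_assoc, ih fun y hy => h y (by simp [hy]),
      List.length_cons, pow_succ]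
    simp [mul_assoc]

theorem mul_orderedProd_of_anticomm {d : Op n} {c : Fin n → Op n} {A : Finset (Fin n)}
    (h : ∀ i ∈ A, d * c i + c i * d = 0) :
    d * orderedProd c A = (-1 : ℂ) ^ A.card • (orderedProd c A * d) := by
  unfold orderedProd
  rw [mul_prod_of_anticomm]
  · simp
  · intro x hx
    simp only [List.mem_map, Finset.mem_sort] at hx
    obtain ⟨i, hi, rfl⟩ := hx
    exact h i hi

/-- Passing `d` through a product costs one sign per factor, and the number of factors is even. -/
theorem IsLocal.commute {S : Finset (Fin n)} {O : Op n} (hO : IsLocal S O) {d : Op n}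
    (hc : ∀ i ∈ S, d * creation i + creation i * d = 0)
    (ha : ∀ i ∈ S, d * annihilation i + annihilation i * d = 0) : Commute O d := by
  refine Submodule.span_induction (p := fun O _ => Commute O d) ?_ (Commute.zero_left _)
    (fun x y _ _ hx hy => hx.add_left hy) (fun a x _ hx => hx.smul_left a) hO
  rintro _ ⟨A, B, hA, hB, he, rfl⟩
  refine Commute.symm ?_
  rw [Commute, SemiconjBy, ← mul_assoc, mul_orderedProd_of_anticomm fun i hi => hc i (hA hi),
    smul_mul_assoc, mul_assoc, mul_orderedProd_of_anticomm fun i hi => ha i (hB hi), mul_smul_comm,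
    smul_smul, ← pow_add, he.neg_one_pow, one_smul, mul_assoc]

theorem IsLocal.commute_creation {S : Finset (Fin n)} {O : Op n} (hO : IsLocal S O) {k : Fin n}
    (hk : k ∉ S) : Commute O (creation k) :=
  hO.commute (fun i _ => creation_anticomm k i) fun i hi => by
    rw [add_comm, annihilation_creation, if_neg]
    rintro rfl; exact hk hi

theorem IsLocal.commute_annihilation {S : Finset (Fin n)} {O : Op n} (hO : IsLocal S O) {k : Fin n}
    (hk : k ∉ S) : Commute O (annihilation k) :=
  hO.commute (fun i hi => by
    rw [annihilation_creation, if_neg]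
    rintro rfl; exact hk hi) fun i _ => annihilation_anticomm k i

theorem isLocal_create_mul {S : Finset (Fin n)} {v w : Fin n → ℂ} (hv : ∀ i ∉ S, v i = 0)
    (hw : ∀ i ∉ S, w i = 0) : IsLocal S (create v * (create w)ᴴ) := by
  rw [IsLocal, conjTranspose_create, create_apply, Finset.sum_mul_sum]
  refine Submodule.sum_mem _ fun i _ => Submodule.sum_mem _ fun j _ => ?_
  by_cases hi : i ∈ S
  · by_cases hj : j ∈ S
    · rw [smul_mul_smul_comm]
      refine Submodule.smul_mem _ _ (Submodule.subset_span ⟨{i}, {j}, by simpa, by simpa, ?_, ?_⟩)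
      · simp
      · simp [orderedProd]
    · simp [hw j hj]
  · simp [hv i hi]

/-- A one-particle state `v` with support `S` such that `M v` vanishes outside `S` yields an
extensively local observable. -/
theorem hasExtensivelyLocalObservable_of_vector {M : Matrix (Fin n) (Fin n) ℂ} {η : Op n}
    (hη : IsTotalMetric M η) (hM : M.PosDef) {S : Finset (Fin n)} (v : Fin n → ℂ)
    (hv : ∀ i ∉ S, v i = 0) (hMv : ∀ i ∉ S, (M *ᵥ v) i = 0) (hne : ∀ i ∈ S, v i ≠ 0) :
    HasExtensivelyLocalObservable η S := by
  refine ⟨_, hη.isObservable_create_mul hM.isHermitian v, isLocal_create_mul hv hMv, ?_⟩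
  intro T hT hloc
  obtain ⟨i, hiS, hiT⟩ := Finset.exists_of_ssubset hT
  have hMv0 : M *ᵥ v ≠ 0 := fun h0 => hne i hiS
    (congrFun (Matrix.mulVec_injective_of_isUnit hM.isUnit (h0.trans (Matrix.mulVec_zero M).symm)) i)
  obtain ⟨j, hj⟩ := Function.ne_iff.1 hMv0
  set w := M *ᵥ v
  have hann : ∀ (u : Fin n → ℂ) (k : Fin n), (create u)ᴴ *ᵥ (Pi.single {k} 1 : Finset (Fin n) → ℂ)
      = star (u k) • vacuum n := by
    intro u k
    rw [conjTranspose_create, Matrix.sum_mulVec, Finset.sum_eq_single k]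
    · rw [Matrix.smul_mulVec, annihilation_mulVec_single_self]
    · intro l _ hl
      rw [Matrix.smul_mulVec, annihilation_mulVec_single]
      simp [hl]
    · simp
  -- Locality to `T` would force commutation with `annihilation i`. Compare vacuum components on the
  -- one-particle state at `j`: one order gives `0`, since the observable kills the vacuum, the
  -- other `star (w j) * v i ≠ 0`.
  have hcomm := congrArg (fun X : Op n => (X *ᵥ (Pi.single {j} 1 : Finset (Fin n) → ℂ)) ∅)
    (hloc.commute_annihilation hiT).eq
  have hann' : ∀ x : Finset (Fin n) → ℂ, (annihilation i *ᵥ x) ∅ = x {i} := by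
    intro x
    rw [Matrix.mulVec, dotProduct, Finset.sum_eq_single {i}]
    · simp [annihilation, creation, sgn]
    · intro S _ hS
      simp [annihilation, creation, hS]
    · simp
  have hL : ((create v * (create w)ᴴ * annihilation i) *ᵥ
      (Pi.single {j} 1 : Finset (Fin n) → ℂ)) ∅ = 0 := by
    rw [← Matrix.mulVec_mulVec, annihilation_mulVec_single]
    split_ifs with h
    · rw [Finset.mem_singleton] at h
      subst h
      have h0 : (create w)ᴴ *ᵥ (Pi.single ∅ 1 : Finset (Fin n) → ℂ) = 0 := by
        change (create w)ᴴ *ᵥ vacuum n = 0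
        simp [conjTranspose_create, Matrix.sum_mulVec, Matrix.smul_mulVec,
          annihilation_mulVec_vacuum]
      rw [Matrix.mulVec_smul, Finset.erase_singleton, ← Matrix.mulVec_mulVec, h0]
      simp
    · simp
  have hR : ((annihilation i * (create v * (create w)ᴴ)) *ᵥ
      (Pi.single {j} 1 : Finset (Fin n) → ℂ)) ∅ = star (w j) * v i := by
    rw [← Matrix.mulVec_mulVec, ← Matrix.mulVec_mulVec, hann, Matrix.mulVec_smul, hann',
      Pi.smul_apply, create_mulVec_vacuum, smul_eq_mul]
  have h0 : star (w j) * v i = 0 := by rw [← hR, ← hL]; exact hcomm.symm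
  rcases mul_eq_zero.1 h0 with h | h
  · exact hj (star_eq_zero.1 h)
  · exact hne i hiS h

/-- If no nonzero one-particle state `v` supported in `S` has `M v` supported in `S`, then all
observables local to `S` are multiples of the identity. -/
theorem not_hasLocalObservable {M : Matrix (Fin n) (Fin n) ℂ} {η : Op n}
    (hη : IsTotalMetric M η) (hM : M.PosDef) {S : Finset (Fin n)}
    (hS : ∀ v : Fin n → ℂ, (∀ i ∉ S, v i = 0) → (∀ i ∉ S, (M *ᵥ v) i = 0) → v = 0) :
    ¬ HasLocalObservable η S := by
  rintro ⟨O, hobs, hloc, hne⟩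
  rw [IsObservable] at hobs
  -- The goal is `P = ⊤`.
  let P : Submodule ℂ (Fin n → ℂ) :=
    { carrier := {w | Commute Oᴴ (create w)}
      zero_mem' := by simp
      add_mem' := fun {a b} ha hb => by
        simp only [Set.mem_ofPred_eq, map_add] at *
        exact ha.add_right hb
      smul_mem' := fun c x hx => by
        simp only [Set.mem_ofPred_eq, map_smul] at *
        exact hx.smul_right c }
  have hsingle : ∀ k ∉ S, Pi.single k 1 ∈ P := by
    intro k hk
    have h := congrArg Matrix.conjTranspose (hloc.commute_annihilation hk).eq
    rw [Matrix.conjTranspose_mul, Matrix.conjTranspose_mul, conjTranspose_annihilation] at h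
    change Commute Oᴴ (create _)
    rw [create_single]
    exact h.symm
  -- Conjugation by `η` turns `O` into `Oᴴ` and `a†(e_k)` into `a†(M e_k)`.
  have hcol : ∀ k ∉ S, M *ᵥ Pi.single k 1 ∈ P := by
    intro k hk
    have h := (hloc.commute_creation hk).eq
    rw [← create_single] at h
    refine (hη.isUnit hM.isUnit).mul_right_cancel ?_
    rw [mul_assoc, ← hη.mul_create, ← mul_assoc, ← hobs, mul_assoc, h, ← mul_assoc,
      hη.mul_create, mul_assoc, hobs, ← mul_assoc]
  have htop : P = ⊤ := by
    by_contra hP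
    obtain ⟨f, hf0, hf⟩ := Submodule.exists_le_ker_of_lt_top P (lt_top_iff_ne_top.2 hP)
    have hfsum : ∀ w, f w = ∑ j, w j * f (Pi.single j 1) := by
      intro w
      rw [LinearMap.pi_apply_eq_sum_univ f w]
      refine Finset.sum_congr rfl fun j _ => ?_
      rw [smul_eq_mul]
      congr 2
      ext k
      simp [Pi.single_apply, eq_comm]
    -- The conjugated coefficients of a functional vanishing on `P` form a state as in `hS`:
    -- vanishing on `e_k` gives its support, and vanishing on `M e_k` gives that of its image, as
    -- `M` is Hermitian.
    have hz := hS (fun j => star (f (Pi.single j 1))) (fun k hk => by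
      rw [LinearMap.mem_ker.1 (hf (hsingle k hk)), star_zero]) (fun k hk => by
      have h := LinearMap.mem_ker.1 (hf (hcol k hk))
      rw [hfsum, ← star_eq_zero] at h
      rw [← h, Matrix.mulVec, dotProduct, star_sum]
      refine Finset.sum_congr rfl fun j _ => ?_
      rw [Matrix.mulVec_single_one, star_mul, mul_comm, Matrix.col_apply, hM.isHermitian.apply])
    refine hf0 (LinearMap.ext fun w => ?_)
    rw [hfsum]
    refine Finset.sum_eq_zero fun j _ => ?_
    rw [star_eq_zero.1 (congrFun hz j), mul_zero]
  have hcre : ∀ k, Commute Oᴴ (creation k) := fun k => by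
    have h : Pi.single k 1 ∈ P := htop ▸ Submodule.mem_top
    rw [← create_single]
    exact h
  have hann : ∀ k, Commute O (annihilation k) := fun k => by
    have h := congrArg Matrix.conjTranspose (hcre k).eq
    rw [Matrix.conjTranspose_mul, Matrix.conjTranspose_mul, Matrix.conjTranspose_conjTranspose,
      conjTranspose_creation] at h
    exact h.symm
  obtain ⟨c, hc⟩ : ∃ c : ℂ, O *ᵥ vacuum n = c • vacuum n := by
    refine ⟨_, eq_smul_vacuum fun i => ?_⟩
    rw [Matrix.mulVec_mulVec, ← (hann i).eq, ← Matrix.mulVec_mulVec, annihilation_mulVec_vacuum,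
      Matrix.mulVec_zero]
  -- Since `η` fixes the vacuum, the eigenvalue passes from `O` to `Oᴴ` without conjugation.
  have hc' : Oᴴ *ᵥ vacuum n = c • vacuum n := by
    have h := congrArg (· *ᵥ vacuum n) hobs
    simp only [← Matrix.mulVec_mulVec, hc, hη.2, Matrix.mulVec_smul] at h
    exact h.symm
  have h := congrArg Matrix.conjTranspose (eq_smul_one_of_commute hcre hc')
  refine hne (star c) ?_
  simpa using h

/-! ### Segments and the kernel of the off-diagonal block -/

theorem IsConnectedSubsystem.exists_eq_Icc {C : Finset (Fin n)} (hC : IsConnectedSubsystem C) :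
    ∃ a b : Fin n, a ≤ b ∧ C = Finset.Icc a b := by
  have hne : C.Nonempty := by
    obtain ⟨x⟩ := hC.nonempty
    exact ⟨x.1, x.2⟩
  refine ⟨C.min' hne, C.max' hne, C.min'_le _ (C.max'_mem hne), ?_⟩
  ext y
  rw [Finset.mem_Icc]
  refine ⟨fun hy => ⟨C.min'_le _ hy, C.le_max' _ hy⟩, fun ⟨h1, h2⟩ => ?_⟩
  by_contra hy
  -- Edges join neighbouring sites, so a walk that avoids `y` cannot cross it.
  have key : ∀ u v : {i | i ∈ C},
      ((SimpleGraph.pathGraph n).induce {i | i ∈ C}).Walk u v → u.1 < y → v.1 < y := by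
    intro u v w
    induction w with
    | nil => exact id
    | @cons u v w h _ ih =>
      refine fun hu => ih ?_
      have h' := SimpleGraph.pathGraph_adj.1 (SimpleGraph.induce_adj.1 h)
      have hv : v.1 ≠ y := by
        intro hv; exact hy (hv ▸ v.2)
      have hv' : v.1.val ≠ y.val := fun h => hv (Fin.ext h)
      rw [Fin.lt_def] at hu ⊢
      omega
  have hlt1 : C.min' hne < y := lt_of_le_of_ne h1 fun h => hy (h ▸ C.min'_mem hne)
  have hlt2 : y < C.max' hne := lt_of_le_of_ne h2 fun h => hy (h ▸ C.max'_mem hne)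
  obtain ⟨w⟩ := hC.preconnected ⟨_, C.min'_mem hne⟩ ⟨_, C.max'_mem hne⟩
  exact (key _ _ w hlt1).asymm hlt2

theorem farMetric_apply_of_lt (γ : ℂ) {i j : Fin n} {d : ℕ} (h : i.val + d + 1 = j.val) :
    farMetric n γ i j = -(Complex.I * (γ.im : ℂ)) * (starRingEnd ℂ γ) ^ d := by
  have h1 : i < j := by rw [Fin.lt_def]; omega
  have h2 : j.val - i.val - 1 = d := by omega
  simp [farMetric, h1.ne, h1, h2]

theorem farMetric_apply_of_gt (γ : ℂ) {i j : Fin n} {d : ℕ} (h : j.val + d + 1 = i.val) :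
    farMetric n γ i j = Complex.I * (γ.im : ℂ) * γ ^ d := by
  have h1 : j < i := by rw [Fin.lt_def]; omega
  have h2 : i.val - j.val - 1 = d := by omega
  simp [farMetric, h1.ne', h1.not_gt, h2]

theorem toBlock_mulVec {M : Matrix (Fin n) (Fin n) ℂ} {S : Finset (Fin n)} {v : Fin n → ℂ}
    (hv : ∀ i ∉ S, v i = 0) (i : {i // i ∉ S}) :
    (M.toBlock (fun i => i ∉ S) (fun j => j ∈ S) *ᵥ fun j => v j.1) i = (M *ᵥ v) i := by
  simp only [Matrix.mulVec, dotProduct, Matrix.toBlock_apply]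
  rw [← Finset.sum_subtype S (fun _ => Iff.rfl) (fun j => M i j * v j)]
  exact Finset.sum_subset (Finset.subset_univ S) fun j _ hj => by rw [hv j hj, mul_zero]

theorem eq_zero_of_kerDim_eq_zero {M : Matrix (Fin n) (Fin n) ℂ} {S : Finset (Fin n)}
    (h : kerDim M S = 0) {v : Fin n → ℂ} (hv : ∀ i ∉ S, v i = 0)
    (hMv : ∀ i ∉ S, (M *ᵥ v) i = 0) : v = 0 := by
  rw [kerDim, Submodule.finrank_eq_zero] at h
  have h0 : (fun j : {j // j ∈ S} => v j.1) = 0 := by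
    rw [← Submodule.mem_bot ℂ, ← h, LinearMap.mem_ker, Matrix.mulVecLin_apply]
    ext i
    rw [toBlock_mulVec hv]
    exact hMv i i.2
  ext i
  by_cases hi : i ∈ S
  · exact congrFun h0 ⟨i, hi⟩
  · exact hv i hi

/-- The functional vanishing on the kernel of the rows to the left of the segment `[a, b]`. -/
def leftFunctional (γ : ℂ) (a b : Fin n) : ({j // j ∈ Finset.Icc a b} → ℂ) →ₗ[ℂ] ℂ :=
  Fintype.linearCombination ℂ fun j => (starRingEnd ℂ γ) ^ (j.1.val - a.val)

/-- The functional vanishing on the kernel of the rows to the right of the segment `[a, b]`. -/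
def rightFunctional (γ : ℂ) (a b : Fin n) : ({j // j ∈ Finset.Icc a b} → ℂ) →ₗ[ℂ] ℂ :=
  Fintype.linearCombination ℂ fun j => γ ^ (b.val - j.1.val)

/-- A row on the left is a multiple of `leftFunctional`, one on the right of `rightFunctional`. The
adjacent row, at `d = 0`, has the nonzero factor `∓i Im γ`, so it alone imposes the whole condition
of its side. -/
theorem mem_ker_toBlock_iff {γ : ℂ} (hγ : γ.im ≠ 0) (a b : Fin n)
    (u : {j // j ∈ Finset.Icc a b} → ℂ) :
    u ∈ LinearMap.ker ((farMetric n γ).toBlock (fun i => i ∉ Finset.Icc a b)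
      (fun j => j ∈ Finset.Icc a b)).mulVecLin ↔
    (a.val ≠ 0 → leftFunctional γ a b u = 0) ∧
      (b.val ≠ n - 1 → rightFunctional γ a b u = 0) := by
  have hI : Complex.I * (γ.im : ℂ) ≠ 0 := by simp [hγ]
  have hleft : ∀ i : {i // i ∉ Finset.Icc a b}, ∀ d, i.1.val + d + 1 = a.val →
      ((farMetric n γ).toBlock (fun i => i ∉ Finset.Icc a b) (fun j => j ∈ Finset.Icc a b) *ᵥ u) i
        = -(Complex.I * (γ.im : ℂ)) * (starRingEnd ℂ γ) ^ d * leftFunctional γ a b u := by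
    intro i d hd
    rw [leftFunctional, Fintype.linearCombination_apply, Finset.mul_sum, Matrix.mulVec, dotProduct]
    refine Finset.sum_congr rfl fun j _ => ?_
    have hj := Fin.le_def.1 (Finset.mem_Icc.1 j.2).1
    rw [Matrix.toBlock_apply, farMetric_apply_of_lt γ (d := d + (j.1.val - a.val)) (by omega),
      pow_add, smul_eq_mul]
    ring
  have hright : ∀ i : {i // i ∉ Finset.Icc a b}, ∀ d, b.val + d + 1 = i.1.val →
      ((farMetric n γ).toBlock (fun i => i ∉ Finset.Icc a b) (fun j => j ∈ Finset.Icc a b) *ᵥ u) i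
        = Complex.I * (γ.im : ℂ) * γ ^ d * rightFunctional γ a b u := by
    intro i d hd
    rw [rightFunctional, Fintype.linearCombination_apply, Finset.mul_sum, Matrix.mulVec, dotProduct]
    refine Finset.sum_congr rfl fun j _ => ?_
    have hj := Fin.le_def.1 (Finset.mem_Icc.1 j.2).2
    rw [Matrix.toBlock_apply, farMetric_apply_of_gt γ (d := d + (b.val - j.1.val)) (by omega),
      pow_add, smul_eq_mul]
    ring
  rw [LinearMap.mem_ker, Matrix.mulVecLin_apply]
  constructor
  · intro h
    refine ⟨fun ha => ?_, fun hb => ?_⟩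
    · have h1 := hleft ⟨⟨a.val - 1, by omega⟩, by
        simp only [Finset.mem_Icc, Fin.le_def]; omega⟩ 0 (by simp only; omega)
      rw [h] at h1
      simpa [hγ] using h1.symm
    · have h1 := hright ⟨⟨b.val + 1, by omega⟩, by
        simp only [Finset.mem_Icc, Fin.le_def]; omega⟩ 0 rfl
      rw [h] at h1
      simpa [hγ] using h1.symm
  · rintro ⟨hl, hr⟩
    ext i
    have hi := i.2
    simp only [Finset.mem_Icc, Fin.le_def, not_and_or, not_le] at hi
    rcases hi with hi | hi
    · rw [hleft i (a.val - 1 - i.1.val) (by omega), hl (by omega), mul_zero]; rfl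
    · rw [hright i (i.1.val - 1 - b.val) (by omega), hr (by omega), mul_zero]; rfl

/-- The first two sites suffice: restricted to them, the pair of functionals has determinant `γ ^ k
* (1 - |γ|²)`, and the witness comes from Cramer's rule. -/
theorem surjective_leftFunctional_prod_rightFunctional {γ : ℂ} (hγ0 : γ ≠ 0) (hγ : ‖γ‖ ≠ 1)
    {a b : Fin n} (hab : a < b) :
    Function.Surjective ((leftFunctional γ a b).prod (rightFunctional γ a b)) := by
  rintro ⟨x, y⟩
  obtain ⟨k, hk⟩ : ∃ k, a.val + k + 1 = b.val := ⟨b.val - a.val - 1, by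
    rw [Fin.lt_def] at hab; omega⟩
  let p : {j // j ∈ Finset.Icc a b} := ⟨a, by simp [hab.le]⟩
  let q : {j // j ∈ Finset.Icc a b} := ⟨⟨a.val + 1, by omega⟩, by
    simp only [Finset.mem_Icc, Fin.le_def]; omega⟩
  have hdet : 1 - γ * (starRingEnd ℂ γ) ≠ 0 := by
    rw [Complex.mul_conj, Complex.normSq_eq_norm_sq, sub_ne_zero]
    intro h
    have h1 : ‖γ‖ ^ 2 = 1 := by exact_mod_cast h.symm
    exact hγ ((pow_eq_one_iff_of_nonneg (norm_nonneg γ) two_ne_zero).1 h1)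
  have hD : γ ^ k ≠ 0 := pow_ne_zero k hγ0
  set t : ℂ := (y - γ ^ (k + 1) * x) / (γ ^ k * (1 - γ * (starRingEnd ℂ γ))) with ht
  have hk1 : b.val - a.val = k + 1 := by omega
  have hk2 : b.val - (a.val + 1) = k := by omega
  refine ⟨(x - (starRingEnd ℂ γ) * t) • Pi.single p 1 + t • Pi.single q 1, ?_⟩
  have hl : leftFunctional γ a b ((x - (starRingEnd ℂ γ) * t) • Pi.single p 1 + t • Pi.single q 1)
      = x := by
    rw [map_add, map_smul, map_smul, leftFunctional, Fintype.linearCombination_apply_single,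
      Fintype.linearCombination_apply_single]
    simp [p, q]
    ring
  have hr : rightFunctional γ a b ((x - (starRingEnd ℂ γ) * t) • Pi.single p 1 + t • Pi.single q 1)
      = y := by
    rw [map_add, map_smul, map_smul, rightFunctional, Fintype.linearCombination_apply_single,
      Fintype.linearCombination_apply_single]
    simp only [p, q, hk1, hk2, smul_eq_mul, one_mul]
    have : γ ^ k * (1 - γ * (starRingEnd ℂ γ)) * t = y - γ ^ (k + 1) * x := by
      rw [ht]; field_simp
    linear_combination this
  exact Prod.ext hl hr

theorem finrank_ker_of_surjective {S : Finset (Fin n)} {W : Type*} [AddCommGroup W] [Module ℂ W]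
    {f : ({j // j ∈ S} → ℂ) →ₗ[ℂ] W} (hf : Function.Surjective f) :
    Module.finrank ℂ W + Module.finrank ℂ (LinearMap.ker f) = S.card := by
  have h := f.finrank_range_add_finrank_ker
  rwa [LinearMap.range_eq_top.2 hf, finrank_top, Module.finrank_fintype_fun_eq_card,
    Fintype.card_coe] at h

theorem kerDim_farMetric_Icc {γ : ℂ} (hγ_im : γ.im ≠ 0) (hγ : ‖γ‖ ≠ 1) {a b : Fin n}
    (hab : a < b) :
    (kerDim (farMetric n γ) (Finset.Icc a b) : ℤ) = ((Finset.Icc a b).card : ℤ) - 2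
      + (if a.val = 0 then 1 else 0) + (if b.val = n - 1 then 1 else 0) := by
  have hγ0 : γ ≠ 0 := by rintro rfl; simp at hγ_im
  have hs := surjective_leftFunctional_prod_rightFunctional hγ0 hγ hab
  have hl : Function.Surjective (leftFunctional γ a b) := Prod.fst_surjective.comp hs
  have hr : Function.Surjective (rightFunctional γ a b) := Prod.snd_surjective.comp hs
  rw [kerDim]
  by_cases ha : a.val = 0 <;> by_cases hb : b.val = n - 1
  · have hk : LinearMap.ker ((farMetric n γ).toBlock (fun i => i ∉ Finset.Icc a b)
        (fun j => j ∈ Finset.Icc a b)).mulVecLin = ⊤ := by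
      ext u; simp [mem_ker_toBlock_iff hγ_im, ha, hb, -LinearMap.mem_ker]
    rw [hk, finrank_top, Module.finrank_fintype_fun_eq_card, Fintype.card_coe, if_pos ha, if_pos hb]
    ring
  · have hk : LinearMap.ker ((farMetric n γ).toBlock (fun i => i ∉ Finset.Icc a b)
        (fun j => j ∈ Finset.Icc a b)).mulVecLin = LinearMap.ker (rightFunctional γ a b) := by
      ext u; rw [mem_ker_toBlock_iff hγ_im]; simp [ha, hb]
    have h := finrank_ker_of_surjective hr
    rw [hk, if_pos ha, if_neg hb, ← h, Module.finrank_self]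
    push_cast; ring
  · have hk : LinearMap.ker ((farMetric n γ).toBlock (fun i => i ∉ Finset.Icc a b)
        (fun j => j ∈ Finset.Icc a b)).mulVecLin = LinearMap.ker (leftFunctional γ a b) := by
      ext u; rw [mem_ker_toBlock_iff hγ_im]; simp [ha, hb]
    have h := finrank_ker_of_surjective hl
    rw [hk, if_neg ha, if_pos hb, ← h, Module.finrank_self]
    push_cast; ring
  · have hk : LinearMap.ker ((farMetric n γ).toBlock (fun i => i ∉ Finset.Icc a b)
        (fun j => j ∈ Finset.Icc a b)).mulVecLin
          = LinearMap.ker ((leftFunctional γ a b).prod (rightFunctional γ a b)) := by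
      ext u; rw [mem_ker_toBlock_iff hγ_im]; simp [ha, hb]
    have h := finrank_ker_of_surjective hs
    rw [hk, if_neg ha, if_neg hb, ← h, Module.finrank_prod, Module.finrank_self]
    push_cast; ring

theorem kerDim_farMetric_singleton {γ : ℂ} (hn : 2 ≤ n) (hγ_im : γ.im ≠ 0) (a : Fin n) :
    kerDim (farMetric n γ) (Finset.Icc a a) = 0 := by
  rw [kerDim, Submodule.finrank_eq_zero, Submodule.eq_bot_iff]
  intro u hu
  obtain ⟨h1, h2⟩ := (mem_ker_toBlock_iff hγ_im a a u).1 hu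
  let p : {j // j ∈ Finset.Icc a a} := ⟨a, by simp⟩
  have hp : ∀ j : {j // j ∈ Finset.Icc a a}, j = p := fun j => Subtype.ext (by
    change j.1 = a; simpa using j.2)
  have hsum : ∀ g : {j // j ∈ Finset.Icc a a} → ℂ, ∑ j, g j = g p := fun g =>
    Fintype.sum_eq_single p fun j hj => absurd (hp j) hj
  have hup : u p = 0 := by
    rw [leftFunctional, Fintype.linearCombination_apply, hsum] at h1
    rw [rightFunctional, Fintype.linearCombination_apply, hsum] at h2
    -- As `2 ≤ n`, some side has a neighbour; its functional has coefficient `1` at the only site.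
    by_cases ha : a.val = 0
    · simpa [p] using h2 (by omega)
    · simpa [p] using h1 ha
  ext j
  rw [hp j, hup]; rfl

/-! ### Construction of extensively local observables -/

/-- The one-particle states supported in `S` which `M` maps to states supported in `S`. -/
def invariantStates (M : Matrix (Fin n) (Fin n) ℂ) (S : Finset (Fin n)) :
    Submodule ℂ (Fin n → ℂ) where
  carrier := {v | (∀ i ∉ S, v i = 0) ∧ ∀ i ∉ S, (M *ᵥ v) i = 0}
  zero_mem' := by simp
  add_mem' := fun {v w} hv hw => ⟨fun i hi => by simp [hv.1 i hi, hw.1 i hi], fun i hi => by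
    simp [Matrix.mulVec_add, hv.2 i hi, hw.2 i hi]⟩
  smul_mem' := fun c v hv => ⟨fun i hi => by simp [hv.1 i hi], fun i hi => by
    simp [Matrix.mulVec_smul, hv.2 i hi]⟩

/-- A vector space over an infinite field is not a finite union of proper subspaces, so one state is
nonzero at all sites of `S` at once. -/
theorem hasExtensivelyLocalObservable_of_invariantStates {M : Matrix (Fin n) (Fin n) ℂ} {η : Op n}
    (hη : IsTotalMetric M η) (hM : M.PosDef) {S : Finset (Fin n)}
    (h : ∀ i ∈ S, ∃ v ∈ invariantStates M S, v i ≠ 0) : HasExtensivelyLocalObservable η S := by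
  obtain ⟨v, hv, hne⟩ := Module.Dual.exists_forall_mem_ne_zero_of_forall_exists
    (invariantStates M S) (fun i : {i // i ∈ S} => (LinearMap.proj i.1 : (Fin n → ℂ) →ₗ[ℂ] ℂ))
    fun i => h i.1 i.2
  exact hasExtensivelyLocalObservable_of_vector hη hM v hv.1 hv.2 fun i hi => hne ⟨i, hi⟩

/-- The entries are the coefficients of `(γ z - 1)(z - γ*)`. The root `γ*` kills the rows on the
left, and the root `1/γ` those on the right. -/
theorem triple_mem_invariantStates (γ : ℂ) {S : Finset (Fin n)} {p q r : Fin n}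
    (hpq : p.val + 1 = q.val) (hqr : q.val + 1 = r.val) (hp : p ∈ S) (hq : q ∈ S) (hr : r ∈ S) :
    (starRingEnd ℂ γ • Pi.single p 1 - (1 + γ * starRingEnd ℂ γ) • Pi.single q 1
      + γ • Pi.single r 1 : Fin n → ℂ) ∈ invariantStates (farMetric n γ) S := by
  refine ⟨fun i hi => ?_, fun i hi => ?_⟩
  · have h1 : i ≠ p := fun h => hi (h ▸ hp)
    have h2 : i ≠ q := fun h => hi (h ▸ hq)
    have h3 : i ≠ r := fun h => hi (h ▸ hr)
    simp [h1, h2, h3]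
  · have h1 : i.val ≠ p.val := fun h => hi (Fin.ext h ▸ hp)
    have h2 : i.val ≠ q.val := fun h => hi (Fin.ext h ▸ hq)
    have h3 : i.val ≠ r.val := fun h => hi (Fin.ext h ▸ hr)
    simp only [Matrix.mulVec_add, Matrix.mulVec_sub, Matrix.mulVec_smul, Matrix.mulVec_single_one,
      Pi.add_apply, Pi.sub_apply, Pi.smul_apply, Matrix.col_apply, smul_eq_mul]
    rcases lt_or_gt_of_ne h1 with h | h
    · obtain ⟨d, hd⟩ : ∃ d, i.val + d + 1 = p.val := ⟨p.val - i.val - 1, by omega⟩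
      rw [farMetric_apply_of_lt γ hd, farMetric_apply_of_lt γ (d := d + 1) (j := q) (by omega),
        farMetric_apply_of_lt γ (d := d + 2) (j := r) (by omega)]
      ring
    · obtain ⟨d, hd⟩ : ∃ d, r.val + d + 1 = i.val := ⟨i.val - r.val - 1, by omega⟩
      rw [farMetric_apply_of_gt γ hd, farMetric_apply_of_gt γ (d := d + 1) (j := q) (by omega),
        farMetric_apply_of_gt γ (d := d + 2) (j := p) (by omega)]
      ring

theorem hasExtensivelyLocalObservable_Icc {γ : ℂ} (hγ0 : γ ≠ 0) (hM : (farMetric n γ).PosDef)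
    {η : Op n} (hη : IsTotalMetric (farMetric n γ) η) {a b : Fin n} (hab : a.val + 2 ≤ b.val) :
    HasExtensivelyLocalObservable η (Finset.Icc a b) := by
  refine hasExtensivelyLocalObservable_of_invariantStates hη hM fun i hi => ?_
  obtain ⟨h1, h2⟩ := Finset.mem_Icc.1 hi
  rw [Fin.le_def] at h1 h2
  -- A window of three sites containing `i`, pushed back to end at `b` when `i` is too close to it.
  obtain ⟨c, hac, hcb, hci⟩ : ∃ c, a.val ≤ c ∧ c + 2 ≤ b.val ∧
      (i.val = c ∨ i.val = c + 1 ∨ i.val = c + 2) := by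
    by_cases h : i.val + 2 ≤ b.val
    · exact ⟨i.val, h1, h, Or.inl rfl⟩
    · exact ⟨b.val - 2, by omega, by omega, by omega⟩
  let p : Fin n := ⟨c, by omega⟩
  let q : Fin n := ⟨c + 1, by omega⟩
  let r : Fin n := ⟨c + 2, by omega⟩
  have hmem : ∀ k : Fin n, c ≤ k.val → k.val ≤ c + 2 → k ∈ Finset.Icc a b := by
    intro k hk1 hk2
    rw [Finset.mem_Icc, Fin.le_def, Fin.le_def]; omega
  refine ⟨_, triple_mem_invariantStates γ (p := p) (q := q) (r := r) rfl rfl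
    (hmem _ (by simp [p]) (by simp [p])) (hmem _ (by simp [q]) (by simp [q]))
    (hmem _ (by simp [r]) (by simp [r])), ?_⟩
  have hpq : p ≠ q := by simp [p, q]
  have hpr : p ≠ r := by simp [p, r]
  have hqr : q ≠ r := by simp [q, r]
  have hsum : 1 + γ * starRingEnd ℂ γ ≠ 0 := by
    rw [Complex.mul_conj]
    have : (0 : ℝ) < 1 + Complex.normSq γ := by linarith [Complex.normSq_nonneg γ]
    exact_mod_cast this.ne'
  rcases hci with h | h | h
  · rw [show i = p from Fin.ext h]
    simpa [hpq, hpr] using hγ0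
  · rw [show i = q from Fin.ext h]
    intro h0
    refine hsum ?_
    simp [hpq.symm, hqr] at h0
    linear_combination -h0
  · rw [show i = r from Fin.ext h]
    simpa [hpr.symm, hqr.symm] using hγ0

theorem hasExtensivelyLocalObservable_pair {M : Matrix (Fin n) (Fin n) ℂ} {η : Op n}
    (hη : IsTotalMetric M η) (hM : M.PosDef) {p q : Fin n} (hpq : p ≠ q) {x y : ℂ}
    (hx : x ≠ 0) (hy : y ≠ 0) (h : ∀ i, i ≠ p → i ≠ q → M i p * x + M i q * y = 0) :
    HasExtensivelyLocalObservable η {p, q} := by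
  refine hasExtensivelyLocalObservable_of_vector hη hM
    (x • Pi.single p 1 + y • Pi.single q 1) (fun i hi => ?_) (fun i hi => ?_) fun i hi => ?_
  · simp only [Finset.mem_insert, Finset.mem_singleton, not_or] at hi
    simp [hi.1, hi.2]
  · simp only [Finset.mem_insert, Finset.mem_singleton, not_or] at hi
    rw [← h i hi.1 hi.2]
    simp [Matrix.mulVec_add, Matrix.mulVec_smul, mul_comm]
  · simp only [Finset.mem_insert, Finset.mem_singleton] at hi
    rcases hi with rfl | rfl
    · simpa [hpq] using hx
    · simpa [hpq.symm] using hy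

end FreeFermion
end

/-! ### Assembly of the four claims -/

theorem lemma7 (n : ℕ) (hn : 2 ≤ n) (γ : ℂ) (hγ_im : γ.im ≠ 0) (hγ : ‖γ‖ ≠ 1)
    (hM : (FreeFermion.farMetric n γ).PosDef)
    (η : FreeFermion.Op n) (hη : FreeFermion.IsTotalMetric (FreeFermion.farMetric n γ) η) :
    (∀ C : Finset (Fin n), FreeFermion.IsConnectedSubsystem C → 3 ≤ C.card →
      FreeFermion.HasExtensivelyLocalObservable η C) ∧
    FreeFermion.HasExtensivelyLocalObservable η {⟨0, by omega⟩, ⟨1, by omega⟩} ∧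
    FreeFermion.HasExtensivelyLocalObservable η {⟨n - 2, by omega⟩, ⟨n - 1, by omega⟩} ∧
    (∀ C : Finset (Fin n), FreeFermion.IsConnectedSubsystem C → ¬ 3 ≤ C.card →
      C ≠ {⟨0, by omega⟩, ⟨1, by omega⟩} → C ≠ {⟨n - 2, by omega⟩, ⟨n - 1, by omega⟩} →
      ¬ FreeFermion.HasLocalObservable η C) ∧
    (∀ C : Finset (Fin n), FreeFermion.IsConnectedSubsystem C →
      (2 ≤ C.card →
        (FreeFermion.kerDim (FreeFermion.farMetric n γ) C : ℤ) =
          (C.card : ℤ) - 2 + (if (⟨0, by omega⟩ : Fin n) ∈ C then 1 else 0)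
            + (if (⟨n - 1, by omega⟩ : Fin n) ∈ C then 1 else 0)) ∧
      (C.card = 1 → FreeFermion.kerDim (FreeFermion.farMetric n γ) C = 0)) := by
  have hγ0 : γ ≠ 0 := by rintro rfl; simp at hγ_im
  refine ⟨fun C hC hcard => ?_, ?_, ?_, fun C hC hcard h0 h1 => ?_, fun C hC => ⟨fun hcard => ?_,
    fun hcard => ?_⟩⟩
  · obtain ⟨a, b, hab, rfl⟩ := hC.exists_eq_Icc
    rw [Fin.card_Icc] at hcard
    exact FreeFermion.hasExtensivelyLocalObservable_Icc hγ0 hM hη (by omega)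
  -- Only rows on the right remain; they are geometric with ratio `γ`, so the state `(1, -γ)` is
  -- killed. At the other end `(-γ*, 1)` plays this role.
  · refine FreeFermion.hasExtensivelyLocalObservable_pair hη hM (by simp) one_ne_zero
      (neg_ne_zero.2 hγ0) fun i hi0 hi1 => ?_
    have hi0' : i.val ≠ 0 := fun h => hi0 (Fin.ext h)
    have hi1' : i.val ≠ 1 := fun h => hi1 (Fin.ext h)
    obtain ⟨d, hd⟩ : ∃ d, 1 + d + 1 = i.val := ⟨i.val - 2, by omega⟩
    rw [FreeFermion.farMetric_apply_of_gt γ (d := d + 1) (by simp only; omega),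
      FreeFermion.farMetric_apply_of_gt γ (d := d) hd]
    ring
  · refine FreeFermion.hasExtensivelyLocalObservable_pair hη hM
      (fun h => by rw [Fin.ext_iff] at h; simp only at h; omega)
      (neg_ne_zero.2 ((map_ne_zero (starRingEnd ℂ)).2 hγ0)) one_ne_zero fun i hi0 hi1 => ?_
    have hi0' : i.val ≠ n - 2 := fun h => hi0 (Fin.ext h)
    have hi1' : i.val ≠ n - 1 := fun h => hi1 (Fin.ext h)
    obtain ⟨d, hd⟩ : ∃ d, i.val + d + 1 = n - 2 := ⟨n - 2 - i.val - 1, by omega⟩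
    rw [FreeFermion.farMetric_apply_of_lt γ (d := d + 1) (j := ⟨n - 1, _⟩) (by simp only; omega),
      FreeFermion.farMetric_apply_of_lt γ (d := d) hd]
    ring
  · refine FreeFermion.not_hasLocalObservable hη hM fun v =>
      FreeFermion.eq_zero_of_kerDim_eq_zero ?_
    obtain ⟨a, b, hab, rfl⟩ := hC.exists_eq_Icc
    rcases hab.eq_or_lt with rfl | hab
    · exact FreeFermion.kerDim_farMetric_singleton hn hγ_im a
    · have hk := FreeFermion.kerDim_farMetric_Icc hγ_im hγ hab
      rw [Fin.card_Icc] at hcard hk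
      rw [Fin.lt_def] at hab
      -- A two-site segment touching an end is one of the excluded pairs, so both conditions are
      -- present and the kernel has dimension `2 - 2`.
      have ha : a.val ≠ 0 := by
        refine fun ha => h0 ?_
        ext k
        simp only [Finset.mem_Icc, Finset.mem_insert, Finset.mem_singleton, Fin.le_def, Fin.ext_iff]
        omega
      have hb : b.val ≠ n - 1 := by
        refine fun hb => h1 ?_
        ext k
        simp only [Finset.mem_Icc, Finset.mem_insert, Finset.mem_singleton, Fin.le_def, Fin.ext_iff]
        omega
      rw [if_neg ha, if_neg hb] at hk
      omega
  · obtain ⟨a, b, hab, rfl⟩ := hC.exists_eq_Icc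
    have hlt : a < b := by
      rw [Fin.card_Icc] at hcard
      rw [Fin.lt_def]; omega
    have h0 : (⟨0, by omega⟩ : Fin n) ∈ Finset.Icc a b ↔ a.val = 0 := by
      simp only [Finset.mem_Icc, Fin.le_def]; omega
    have h1 : (⟨n - 1, by omega⟩ : Fin n) ∈ Finset.Icc a b ↔ b.val = n - 1 := by
      simp only [Finset.mem_Icc, Fin.le_def]; omega
    simp only [h0, h1]
    exact FreeFermion.kerDim_farMetric_Icc hγ_im hγ hlt
  · obtain ⟨a, b, hab, rfl⟩ := hC.exists_eq_Icc
    rw [Fin.card_Icc] at hcard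
    have : a = b := by
      rw [Fin.le_def] at hab
      exact Fin.ext (by omega)
    subst this
    exact FreeFermion.kerDim_farMetric_singleton hn hγ_im a
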